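/- Let $C$ be a smooth projective (integral) curve over $\mathbb{C}$ with a fixed closed embedding $C\subseteq\mathbb{P}^N$, with respect to which Hilbert polynomials are taken. For $P\in\mathbb{Q}[t]$ let $\mathrm{Hilb}_C^P$ be the Hilbert scheme parametrizing the nonempty closed subschemes of $C$ with Hilbert polynomial $P$ (so that $\mathrm{Hilb}_C^0=\emptyset$). A finite family $(P_1,\dots,P_s)$ of polynomials in $\mathbb{Q}[t]$ is called a good partition of $P$ if $\sum_{i=1}^s P_i=P$ and $\mathrm{Hilb}_C^{P_i}\neq\emptyset$ for all $i$. A partition of a positive integer $n$ is a tuple $(n_1,\dots,n_s)$ of positive integers with $\sum_{i=1}^s n_i=n$. Let $n$ be a positive integer, and view integers as constant polynomials. Then every partition of $n$ is a good partition of $n$, and conversely every good partition of $n$ is a partition of $n$ (in particular, all its members are constant polynomials given by positive integers). Moreover, for an integer $k$, the Hilbert scheme $\mathrm{Hilb}_C^k$ is nonempty if and only if $k>0$. -/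

import Mathlib

open CategoryTheory CategoryTheory.Limits AlgebraicGeometry

noncomputable section

namespace HilbertCurve

/-! ### Projective space over the complex numbers -/

/-- The standard grading of `ℂ[x₀, …, x_N]` by degree. -/
abbrev grading (N : ℕ) : ℕ → Submodule ℂ (MvPolynomial (Fin (N + 1)) ℂ) :=
  MvPolynomial.homogeneousSubmodule (Fin (N + 1)) ℂ

instance (N : ℕ) : GradedAlgebra (grading N) := MvPolynomial.gradedAlgebra

/-- Projective space `ℙ^N = Proj ℂ[x₀, …, x_N]`. -/
abbrev ProjSpace (N : ℕ) : Scheme.{0} := Proj (grading N)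

/-- The structure morphism `ℙ^N ⟶ Spec ℂ`. -/
def ProjSpace.toSpec (N : ℕ) : ProjSpace N ⟶ Spec (.of ℂ) :=
  Proj.toSpecZero (grading N) ≫ Spec.map (CommRingCat.ofHom (algebraMap ℂ (grading N 0)))

/-- The standard chart `D₊(xᵢ)` of `ℙ^N`. -/
abbrev chart {N : ℕ} (i : Fin (N + 1)) : (ProjSpace N).Opens :=
  Proj.basicOpen (grading N) (MvPolynomial.X i)

theorem X_mem_grading {N : ℕ} (i : Fin (N + 1)) :
    (MvPolynomial.X i : MvPolynomial (Fin (N + 1)) ℂ) ∈ grading N 1 :=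
  (MvPolynomial.mem_homogeneousSubmodule 1 _).2 (MvPolynomial.isHomogeneous_X ℂ i)

/-- The regular function `xⱼ / xᵢ` on the chart `D₊(xᵢ)`. -/
def coordRatio {N : ℕ} (j i : Fin (N + 1)) : Γ(ProjSpace N, chart i) :=
  (Proj.awayToSection (grading N) (MvPolynomial.X i)).hom
    (HomogeneousLocalization.Away.mk (grading N) (X_mem_grading i) 1
      (MvPolynomial.X j) (by rw [one_smul]; exact X_mem_grading j))

/-! ### Hilbert polynomials of closed subschemes of projective space -/

section HilbertPolynomial

variable {K : Type} [Field K] {N : ℕ} {Z : Scheme.{0}}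

/-- For a `K`-scheme `g : Z ⟶ Spec K` and an open `U` of `Z`, the ring homomorphism
`K → Γ(Z, U)` making `Γ(Z, U)` a `K`-algebra. -/
def scalarMap (g : Z ⟶ Spec (.of K)) (U : Z.Opens) : K →+* Γ(Z, U) :=
  ((Scheme.ΓSpecIso (.of K)).inv ≫ g.appLE ⊤ U le_top).hom

/-- Let `Z` be a `K`-scheme with a morphism `φ` to `ℙ^N`. The dehomogenization of a polynomial
`F ∈ K[x₀, …, x_N]` with respect to `xᵢ`, pulled back to `Z`: it is the function
`F(x₀ / xᵢ, …, x_N / xᵢ)` on the open subset `φ⁻¹ D₊(xᵢ)` of `Z`. If `F` is a form of degree `t`,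
this is `F / xᵢ ^ t`. -/
def restrictToChart (g : Z ⟶ Spec (.of K)) (φ : Z ⟶ ProjSpace N) (i : Fin (N + 1)) :
    MvPolynomial (Fin (N + 1)) K →+* Γ(Z, φ ⁻¹ᵁ chart i) :=
  MvPolynomial.eval₂Hom (scalarMap g (φ ⁻¹ᵁ chart i)) fun j ↦ (φ.app (chart i)).hom (coordRatio j i)

/-- The degree `t` part `I(Z)_t` of the saturated homogeneous ideal of `Z` in `K[x₀, …, x_N]`:
the forms of degree `t` with coefficients in `K` that vanish on `Z`. -/
def vanishingForms (g : Z ⟶ Spec (.of K)) (φ : Z ⟶ ProjSpace N) (t : ℕ) :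
    Submodule K (MvPolynomial.homogeneousSubmodule (Fin (N + 1)) K t) where
  carrier := {F | ∀ i, restrictToChart g φ i (F : MvPolynomial (Fin (N + 1)) K) = 0}
  zero_mem' i := by simp
  add_mem' {F G} hF hG i := by simp [hF i, hG i]
  smul_mem' a F hF i := by simp [MvPolynomial.smul_eq_C_mul, hF i]

/-- The Hilbert function `t ↦ dim_K (K[x₀, …, x_N] / I(Z))_t` of `Z`. It is meant for `Z` a
closed subscheme of `ℙ^N_K`, given by its structure morphism `g` to `Spec K` and the composite
`φ` of the inclusion into `ℙ^N_K = ℙ^N × Spec K` with the projection to `ℙ^N`. -/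
def hilbertFunction (g : Z ⟶ Spec (.of K)) (φ : Z ⟶ ProjSpace N) (t : ℕ) : ℕ :=
  Module.finrank K
    (MvPolynomial.homogeneousSubmodule (Fin (N + 1)) K t ⧸ vanishingForms g φ t)

/-- `P` is the Hilbert polynomial of `Z`: it agrees with the Hilbert function in all large
degrees. -/
def HasHilbertPolynomial (g : Z ⟶ Spec (.of K)) (φ : Z ⟶ ProjSpace N)
    (P : Polynomial ℚ) : Prop :=
  ∀ᶠ t : ℕ in Filter.atTop, (hilbertFunction g φ t : ℚ) = P.eval (t : ℚ)

end HilbertPolynomial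

/-! ### Curves -/

/-- A smooth projective (integral) curve over `ℂ`, with a projective embedding; the embedding is
what Hilbert polynomials on the curve refer to. -/
structure SmoothProjectiveCurve where
  /-- the underlying scheme -/
  X : Scheme.{0}
  /-- the dimension of the ambient projective space -/
  N : ℕ
  /-- the projective embedding -/
  ι : X ⟶ ProjSpace N
  isClosedImmersion : IsClosedImmersion ι
  isIntegral : IsIntegral X
  smooth : Smooth (ι ≫ ProjSpace.toSpec N)
  dim_eq_one : topologicalKrullDim X = 1

namespace SmoothProjectiveCurve

variable (C : SmoothProjectiveCurve)

/-- The structure morphism `C ⟶ Spec ℂ`. -/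
def str : C.X ⟶ Spec (.of ℂ) := C.ι ≫ ProjSpace.toSpec C.N

/-- The product `C × S` over `ℂ`, for a `ℂ`-scheme `σ : S ⟶ Spec ℂ`. -/
abbrev prod {S : Scheme.{0}} (σ : S ⟶ Spec (.of ℂ)) : Scheme.{0} := pullback C.str σ

/-- The morphism `id × f : C × T ⟶ C × S` induced by a morphism `f : T ⟶ S` of `ℂ`-schemes. -/
def prodMap {S T : Scheme.{0}} {σ : S ⟶ Spec (.of ℂ)} {τ : T ⟶ Spec (.of ℂ)} (f : T ⟶ S)
    (hf : f ≫ σ = τ) : C.prod τ ⟶ C.prod σ :=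
  pullback.map C.str τ C.str σ (𝟙 _) f (𝟙 _) (by simp) (by simp [hf])

/-! ### The Hilbert scheme through its functor of points -/

section Family

variable {S : Scheme.{0}} {σ : S ⟶ Spec (.of ℂ)} (I : (C.prod σ).IdealSheafData)

/-- The projection to `S` of the closed subscheme `Z ⊆ C × S` with ideal sheaf `I`. -/
def familyMap : I.subscheme ⟶ S := I.subschemeι ≫ pullback.snd C.str σ

/-- The fibre `Z_s` of the closed subscheme `Z ⊆ C × S` with ideal sheaf `I` over a point `s` of
`S`. It is a closed subscheme of `C × Spec κ(s)`. -/
def fibre (s : S) : Scheme.{0} := (C.familyMap I).fiber s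

/-- The structure morphism `Z_s ⟶ Spec κ(s)`. -/
def fibreStr (s : S) : C.fibre I s ⟶ Spec (.of (S.residueField s)) :=
  (C.familyMap I).fiberToSpecResidueField s

/-- The morphism `Z_s ⟶ C × Spec κ(s) ⟶ C ⟶ ℙ^N`. -/
def fibreToProjSpace (s : S) : C.fibre I s ⟶ ProjSpace C.N :=
  (C.familyMap I).fiberι s ≫ I.subschemeι ≫ pullback.fst C.str σ ≫ C.ι

/-- The families of nonempty closed subschemes of `C` with Hilbert polynomial `P` parametrized by
a `ℂ`-scheme `S`: the closed subschemes of `C × S` that are flat over `S` and all whose fibres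
over points of `S` are nonempty and have Hilbert polynomial `P`. -/
structure IsHilbertFamily (P : Polynomial ℚ) : Prop where
  flat : Flat (C.familyMap I)
  nonempty_fibre : ∀ s : S, Nonempty (C.fibre I s)
  hasHilbertPolynomial : ∀ s : S,
    HasHilbertPolynomial (C.fibreStr I s) (C.fibreToProjSpace I s) P

end Family

/-- The `ℂ`-scheme `η : H ⟶ Spec ℂ` is the Hilbert scheme `Hilb_C^P`: it is locally noetherian and
represents the functor that sends a locally noetherian `ℂ`-scheme to the set of families of
nonempty closed subschemes of `C` with Hilbert polynomial `P` parametrized by it, that is, it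
carries a universal such family. -/
def IsHilbertScheme (P : Polynomial ℚ) {H : Scheme.{0}} (η : H ⟶ Spec (.of ℂ)) : Prop :=
  IsLocallyNoetherian H ∧ ∃ U : (C.prod η).IdealSheafData, C.IsHilbertFamily U P ∧
    ∀ (T : Scheme.{0}) (τ : T ⟶ Spec (.of ℂ)), IsLocallyNoetherian T →
      ∀ I : (C.prod τ).IdealSheafData, C.IsHilbertFamily I P →
        ∃! f : T ⟶ H, ∃ hf : f ≫ η = τ, U.comap (C.prodMap f hf) = I

/-- `Hilb_C^P ≠ ∅`, expressed through the functor of points of the Hilbert scheme: over some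
nonempty (locally noetherian) `ℂ`-scheme `S` there is a family of closed subschemes of `C` with
Hilbert polynomial `P`, in other words there is a morphism from a nonempty scheme to the Hilbert
scheme. -/
def HilbNonempty (P : Polynomial ℚ) : Prop :=
  ∃ (S : Scheme.{0}) (σ : S ⟶ Spec (.of ℂ)) (I : (C.prod σ).IdealSheafData),
    IsLocallyNoetherian S ∧ Nonempty S ∧ C.IsHilbertFamily I P

/-- `HilbNonempty` says that the Hilbert scheme, as a scheme, is nonempty. -/
theorem hilbNonempty_iff {P : Polynomial ℚ} {H : Scheme.{0}} {η : H ⟶ Spec (.of ℂ)}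
    (h : C.IsHilbertScheme P η) : C.HilbNonempty P ↔ Nonempty H := by
  obtain ⟨hH, U, hU, huniv⟩ := h
  constructor
  · rintro ⟨S, σ, I, hS, ⟨s⟩, hI⟩
    obtain ⟨f, -, -⟩ := huniv S σ hS I hI
    exact ⟨f s⟩
  · exact fun hne ↦ ⟨H, η, U, hH, hne, hU⟩

/-! ### Partitions and good partitions -/

/-- A finite family `(P₁, …, P_s)` of polynomials with rational coefficients is a good partition
of `P` if its sum is `P` and `Hilb_C^{P_i}` is nonempty for every `i`. -/
def IsGoodPartition (P : Polynomial ℚ) {s : ℕ} (Q : Fin s → Polynomial ℚ) : Prop :=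
  ∑ i, Q i = P ∧ ∀ i, C.HilbNonempty (Q i)

end SmoothProjectiveCurve

/-- A partition of `n` of length `s`: an `s`-tuple of positive integers with sum `n`. -/
def IsPartition (n : ℕ) {s : ℕ} (m : Fin s → ℕ) : Prop :=
  ∑ i, m i = n ∧ ∀ i, 0 < m i

/-- An integer viewed as a constant polynomial with rational coefficients. -/
def constPoly (k : ℤ) : Polynomial ℚ := Polynomial.C (k : ℚ)

end HilbertCurve

end

/-!
The Hilbert function of a nonempty subscheme of projective space takes positive integer values. So
in large degrees the members of a good partition of `n` take positive integer values with sum `n`;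
polynomials that stay bounded at large integers are constant, hence these are positive integers.
Conversely, a curve is a positive-dimensional Jacobson space and so has infinitely many closed
points. A set of `n` of them is a reduced finite closed subscheme, whose Hilbert function is
eventually `n` because the forms of a large degree separate the points.
-/

noncomputable section

namespace HilbertCurve

section Algebra

open MvPolynomial HomogeneousLocalization

theorem finrank_quotient_iInf_ker_eq_card {K V ι : Type*} [Field K] [AddCommGroup V] [Module K V]
    [Fintype ι] (f : ι → V →ₗ[K] K) (v : ι → V) (hne : ∀ i, f i (v i) ≠ 0)
    (hzero : ∀ i j, j ≠ i → f j (v i) = 0) :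
    Module.finrank K (V ⧸ ⨅ i, LinearMap.ker (f i)) = Fintype.card ι := by
  classical
  have hsurj : Function.Surjective (LinearMap.pi f) := fun w ↦ by
    refine ⟨∑ i, (w i / f i (v i)) • v i, funext fun j ↦ ?_⟩
    rw [LinearMap.pi_apply, map_sum, Finset.sum_eq_single j]
    · rw [map_smul, smul_eq_mul, div_mul_cancel₀ _ (hne j)]
    · intro i _ hij
      rw [map_smul, hzero i j hij.symm, smul_zero]
    · simp
  rw [← LinearMap.ker_pi, ((LinearMap.pi f).quotKerEquivOfSurjective hsurj).finrank_eq,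
    Module.finrank_fintype_fun_eq_card]

theorem eval₂_mul_left_of_isHomogeneous {σ R S : Type*} [CommSemiring R] [CommSemiring S]
    {F : MvPolynomial σ R} {t : ℕ} (hF : F.IsHomogeneous t) (f : R →+* S) (u : S) (a : σ → S) :
    eval₂ f (fun j ↦ u * a j) F = u ^ t * eval₂ f a F := by
  simp only [eval₂_eq, Finset.mul_sum]
  refine Finset.sum_congr rfl fun d hd ↦ ?_
  have hdeg : ∑ i ∈ d.support, d i = t := by
    simpa [Finsupp.weight_apply, Finsupp.sum] using hF (mem_support_iff.1 hd)
  rw [mul_left_comm, ← hdeg, ← Finset.prod_pow_eq_pow_sum, ← Finset.prod_mul_distrib]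
  simp only [mul_pow]

theorem eq_C_of_eventually_eval_natCast_mem_Icc {𝕜 : Type*} [NormedField 𝕜] [LinearOrder 𝕜]
    [IsStrictOrderedRing 𝕜] [OrderTopology 𝕜] [Archimedean 𝕜] {P : Polynomial 𝕜} {a b : 𝕜}
    (h : ∀ᶠ t : ℕ in Filter.atTop, P.eval (t : 𝕜) ∈ Set.Icc a b) :
    P = Polynomial.C (P.coeff 0) := by
  refine Polynomial.eq_C_of_degree_le_zero (le_of_not_gt fun hdeg ↦ ?_)
  have htend := (P.abs_tendsto_atTop hdeg).comp (tendsto_natCast_atTop_atTop (R := 𝕜))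
  obtain ⟨t, ht, hlt⟩ := (h.and (htend.eventually_gt_atTop (max |a| |b|))).exists
  exact (abs_le_max_abs_abs ht.1 ht.2).not_gt hlt

section Proj

variable {A τ : Type*} [CommRing A] [SetLike τ A] [AddSubgroupClass τ A] (𝒜 : ℕ → τ) [GradedRing 𝒜]

theorem exists_homogeneous_notMem_of_notMem_isClosed {T : Set (ProjectiveSpectrum 𝒜)}
    (hT : IsClosed T) {x : ProjectiveSpectrum 𝒜} (hx : x ∉ T) :
    ∃ d, ∃ G ∈ 𝒜 d, G ∉ x.asHomogeneousIdeal ∧ ∀ y ∈ T, G ∈ y.asHomogeneousIdeal := by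
  obtain ⟨s, rfl⟩ := (ProjectiveSpectrum.isClosed_iff_zeroLocus 𝒜 T).1 hT
  obtain ⟨a, has, hax⟩ := Set.not_subset.1 hx
  obtain ⟨d, hd⟩ := not_forall.1 ((x.asHomogeneousIdeal.isHomogeneous.mem_iff 𝒜).not.1 hax)
  exact ⟨d, _, SetLike.coe_mem _, hd, fun y hy ↦ y.asHomogeneousIdeal.isHomogeneous d (hy has)⟩

theorem isUnit_mapId_mk_iff_num_notMem {x : ProjectiveSpectrum 𝒜} {f : A}
    (hx : f ∉ x.asHomogeneousIdeal) (z : NumDenSameDeg 𝒜 (.powers f)) :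
    IsUnit (mapId 𝒜 (Submonoid.powers_le.mpr hx :
      _ ≤ x.asHomogeneousIdeal.toIdeal.primeCompl) (.mk z)) ↔ z.num.1 ∉ x.asHomogeneousIdeal := by
  rw [← HomogeneousLocalization.isUnit_iff_isUnit_val]
  change IsUnit (Localization.mk _ _) ↔ _
  rw [Localization.mk_eq_mk', IsLocalization.AtPrime.isUnit_mk'_iff]
  rfl

end Proj

section Dehomogenization

attribute [local instance] MvPolynomial.gradedAlgebra

variable {σ R : Type*} [CommRing R]

theorem X_mem_homogeneousSubmodule (i : σ) : X i ∈ homogeneousSubmodule σ R 1 :=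
  (mem_homogeneousSubmodule 1 _).2 (isHomogeneous_X R i)

theorem iSup_basicOpen_X_eq_top :
    ⨆ i, Proj.basicOpen (homogeneousSubmodule σ R) (X i) = ⊤ := by
  refine Proj.iSup_basicOpen_eq_top' _ _ (fun i ↦ ⟨1, isHomogeneous_X R i⟩) (top_le_iff.1 ?_)
  intro F _
  induction F using MvPolynomial.induction_on with
  | C a =>
    exact Subalgebra.algebraMap_mem _ (⟨C a, isHomogeneous_C σ a⟩ : homogeneousSubmodule σ R 0)
  | add F G hF hG => exact add_mem (hF trivial) (hG trivial)
  | mul_X F i hF => exact mul_mem (hF trivial) (Algebra.subset_adjoin ⟨i, rfl⟩)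

/-- The dehomogenization `F ↦ F(x₀ / xᵢ, x₁ / xᵢ, …)`, with values in the degree zero part of the
localization of `R[x₀, x₁, …]` away from `xᵢ`. -/
def dehomogenize (i : σ) :
    MvPolynomial σ R →+* Away (homogeneousSubmodule σ R) (X i) :=
  eval₂Hom ((fromZeroRingHom (homogeneousSubmodule σ R) _).comp
      (algebraMap R (homogeneousSubmodule σ R 0)))
    fun j ↦ Away.mk (homogeneousSubmodule σ R) (X_mem_homogeneousSubmodule i) 1 (X j)
      (by rw [one_smul]; exact X_mem_homogeneousSubmodule j)

theorem algebraMap_dehomogenize (i : σ) (F : MvPolynomial σ R) :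
    algebraMap _ (Localization.Away (X i : MvPolynomial σ R)) (dehomogenize i F) =
      eval₂ (algebraMap R _) (fun j ↦ IsLocalization.Away.invSelf (X i : MvPolynomial σ R) *
        algebraMap (MvPolynomial σ R) _ (X j)) F := by
  let L := Localization.Away (X i : MvPolynomial σ R)
  suffices (algebraMap _ L).comp (dehomogenize i) = eval₂Hom (algebraMap R L)
      (fun j ↦ IsLocalization.Away.invSelf (X i : MvPolynomial σ R) *
        algebraMap (MvPolynomial σ R) L (X j)) from congr($this F)
  refine ringHom_ext (fun a ↦ ?_) fun j ↦ ?_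
  · rw [RingHom.comp_apply, dehomogenize, eval₂Hom_C, eval₂Hom_C,
      IsScalarTower.algebraMap_apply R (MvPolynomial σ R) L, ← Localization.mk_one_eq_algebraMap]
    rfl
  · rw [RingHom.comp_apply, dehomogenize, eval₂Hom_X', eval₂Hom_X']
    refine (Away.val_mk _ _ (X_mem_homogeneousSubmodule i) _ _).trans ?_
    rw [IsLocalization.Away.invSelf, ← Localization.mk_eq_mk', ← Localization.mk_one_eq_algebraMap,
      Localization.mk_mul]
    simp only [pow_one, one_mul, mul_one]

theorem dehomogenize_eq_mk (i : σ) {F : MvPolynomial σ R} {t : ℕ}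
    (hF : F ∈ homogeneousSubmodule σ R t) :
    dehomogenize i F = Away.mk (homogeneousSubmodule σ R) (X_mem_homogeneousSubmodule i) t F
      (by rwa [smul_eq_mul, mul_one]) := by
  let L := Localization.Away (X i : MvPolynomial σ R)
  have hL : eval₂ (algebraMap R L) (fun j ↦ algebraMap (MvPolynomial σ R) L (X j)) F =
      algebraMap _ L F := by
    rw [IsScalarTower.algebraMap_eq R (MvPolynomial σ R) L, MvPolynomial.algebraMap_eq,
      ← Function.comp_def, ← eval₂_comp_left, eval₂_eta]
  ext
  refine (algebraMap_dehomogenize i F).trans ?_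
  rw [eval₂_mul_left_of_isHomogeneous hF, hL, Away.val_mk, IsLocalization.Away.invSelf,
    ← Localization.mk_eq_mk', ← Localization.mk_one_eq_algebraMap,
    Localization.mk_pow, Localization.mk_mul, one_pow, one_mul, mul_one]
  rfl

end Dehomogenization

end Algebra

section ScalarMap

variable {K : Type} [Field K] {Z : Scheme.{0}}

theorem toSpecΓ_specMap_scalarMap (g : Z ⟶ Spec (.of K)) (U : Z.Opens) :
    U.toSpecΓ ≫ Spec.map (CommRingCat.ofHom (scalarMap g U)) = U.ι ≫ g := by
  rw [scalarMap, CommRingCat.ofHom_hom, Spec.map_comp]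
  refine (Scheme.Opens.toSpecΓ_SpecMap_appLE_assoc g ⊤ U le_top _).trans ?_
  rw [Scheme.Opens.toSpecΓ_top, Category.assoc, toSpecΓ_SpecMap_ΓSpecIso_inv, Category.comp_id]
  exact Scheme.Hom.resLE_comp_ι g le_top

theorem toSpecΓ_comp_specMap_injective (U : Z.Opens) (R : CommRingCat.{0}) :
    Function.Injective fun f : R ⟶ Γ(Z, U) ↦ U.toSpecΓ ≫ Spec.map f := by
  intro f f' h
  have := congr(($h).appTop)
  rwa [Scheme.Hom.comp_appTop, Scheme.Hom.comp_appTop, Scheme.Opens.toSpecΓ_appTop,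
    Scheme.ΓSpecIso_naturality_assoc, Scheme.ΓSpecIso_naturality_assoc, cancel_epi,
    cancel_mono] at this

theorem scalarMap_eq_iff {g : Z ⟶ Spec (.of K)} {U : Z.Opens} {f : K →+* Γ(Z, U)} :
    scalarMap g U = f ↔ U.toSpecΓ ≫ Spec.map (CommRingCat.ofHom f) = U.ι ≫ g := by
  rw [← toSpecΓ_specMap_scalarMap, (toSpecΓ_comp_specMap_injective U _).eq_iff]
  exact ⟨fun h ↦ congr(CommRingCat.ofHom $h.symm), fun h ↦ congr(($h.symm).hom)⟩

theorem scalarMap_comp {Y : Scheme.{0}} (φ : Z ⟶ Y) (g : Y ⟶ Spec (.of K)) (U : Y.Opens) :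
    scalarMap (φ ≫ g) (φ ⁻¹ᵁ U) = (φ.app U).hom.comp (scalarMap g U) := by
  rw [scalarMap_eq_iff, CommRingCat.ofHom_comp, Spec.map_comp, CommRingCat.ofHom_hom,
    Scheme.Opens.toSpecΓ_naturality_assoc, toSpecΓ_specMap_scalarMap, morphismRestrict_ι_assoc]

theorem scalarMap_comp_specMap {k : Type} [Field k] (f : k →+* K) (g : Z ⟶ Spec (.of K))
    (U : Z.Opens) :
    scalarMap (g ≫ Spec.map (CommRingCat.ofHom f)) U = (scalarMap g U).comp f := by
  rw [scalarMap_eq_iff, CommRingCat.ofHom_comp, Spec.map_comp, ← Category.assoc,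
    toSpecΓ_specMap_scalarMap, Category.assoc]

theorem evaluation_scalarMap {g : Z ⟶ Spec (.of K)} {z : Z}
    {f : CommRingCat.of K ⟶ Z.residueField z} (hf : Spec.map f = Z.fromSpecResidueField z ≫ g)
    (U : Z.Opens) (hz : z ∈ U) (a : K) :
    Z.evaluation U z hz (scalarMap g U a) = f a := by
  suffices CommRingCat.ofHom (scalarMap g U) ≫ Z.evaluation U z hz = f from congr(($this).hom a)
  refine Spec.map_injective ?_
  rw [hf, ← Scheme.germ_residue, Spec.map_comp, Spec.map_comp,
    ← Scheme.Opens.fromSpecStalkOfMem_toSpecΓ, Category.assoc, Category.assoc,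
    toSpecΓ_specMap_scalarMap, Scheme.Opens.fromSpecStalkOfMem_ι_assoc, Scheme.fromSpecResidueField,
    Category.assoc]

theorem residueFieldIsoBase_hom_evaluation_scalarMap [IsAlgClosed K] (g : Z ⟶ Spec (.of K))
    [LocallyOfFiniteType g] (U : Z.Opens) {z : Z} (hz : z ∈ U) (hcl : IsClosed {z}) (a : K) :
    (residueFieldIsoBase g z hcl).hom (Z.evaluation U z hz (scalarMap g U a)) = a := by
  rw [evaluation_scalarMap (SpecMap_residueFieldIsoBase_inv g z hcl)]
  exact (residueFieldIsoBase g z hcl).inv_hom_id_apply a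

end ScalarMap

section Proj

open HomogeneousLocalization

variable {A τ : Type*} [CommRing A] [SetLike τ A] [AddSubgroupClass τ A] (𝒜 : ℕ → τ) [GradedRing 𝒜]

theorem away_mk_self {f : A} {d : ℕ} (hf : f ∈ 𝒜 d) :
    Away.mk 𝒜 hf 1 f (by rwa [one_smul]) = 1 := by
  ext
  rw [Away.val_mk, val_one]
  refine Eq.trans ?_ (Localization.mk_self (⟨f, Submonoid.mem_powers f⟩ : Submonoid.powers f))
  simp only [pow_one]

theorem evaluation_awayToSection_mk_eq_zero_iff {f : A} {q : Proj 𝒜} (hq : q ∈ Proj.basicOpen 𝒜 f)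
    (z : NumDenSameDeg 𝒜 (.powers f)) :
    (Proj 𝒜).evaluation (Proj.basicOpen 𝒜 f) q hq
      ((Proj.awayToSection 𝒜 f).hom (HomogeneousLocalization.mk z)) = 0 ↔
        z.num.1 ∈ q.asHomogeneousIdeal := by
  have hgerm : (Proj 𝒜).presheaf.germ (Proj.basicOpen 𝒜 f) q hq
      ((Proj.awayToSection 𝒜 f).hom (HomogeneousLocalization.mk z)) =
        (Proj.stalkIso 𝒜 q).inv.hom (mapId 𝒜 (Submonoid.powers_le.mpr hq) (.mk z)) :=
    congr(($(ProjectiveSpectrum.Proj.awayToSection_germ 𝒜 f q hq)).hom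
      (HomogeneousLocalization.mk z))
  rw [Scheme.evaluation_eq_zero_iff_notMem_basicOpen, Scheme.mem_basicOpen _ _ _ hq, hgerm,
    ← not_iff_not, not_not, ← isUnit_mapId_mk_iff_num_notMem 𝒜 hq]
  exact MulEquiv.isUnit_map (Proj.stalkIso 𝒜 q).symm.commRingCatIsoToRingEquiv

end Proj

section ProjSpace

open MvPolynomial HomogeneousLocalization

variable {N : ℕ}

theorem exists_mem_chart (q : ProjSpace N) : ∃ i : Fin (N + 1), q ∈ chart i := by
  have hq : q ∈ ⨆ i : Fin (N + 1), chart i := iSup_basicOpen_X_eq_top.ge trivial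
  simpa only [TopologicalSpace.Opens.mem_iSup] using hq

theorem coordRatio_self (i : Fin (N + 1)) : coordRatio i i = 1 := by
  rw [coordRatio, away_mk_self, map_one]

theorem scalarMap_toSpec (i : Fin (N + 1)) : scalarMap (ProjSpace.toSpec N) (chart i) =
    (Proj.awayToSection (grading N) (X i)).hom.comp ((dehomogenize i).comp C) := by
  have h := Proj.awayι_toSpecZero (grading N) (X i) (X_mem_grading i) one_pos
  rw [Proj.awayι, Category.assoc, Iso.inv_comp_eq] at h
  rw [scalarMap_eq_iff, ProjSpace.toSpec, reassoc_of% h, Proj.basicOpenIsoSpec_hom,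
    Proj.basicOpenToSpec, dehomogenize]
  simp [← Spec.map_comp]

variable {K : Type} [Field K] {Z : Scheme.{0}} {g : Z ⟶ Spec (.of K)} {φ : Z ⟶ ProjSpace N}
  {c : ℂ →+* K}

theorem restrictToChart_map (h : g ≫ Spec.map (CommRingCat.ofHom c) = φ ≫ ProjSpace.toSpec N)
    (i : Fin (N + 1)) (F : MvPolynomial (Fin (N + 1)) ℂ) :
    restrictToChart g φ i (map c F) = (φ.app (chart i)).hom
      ((Proj.awayToSection (grading N) (X i)).hom (dehomogenize i F)) := by
  suffices (restrictToChart g φ i).comp (map c) = (φ.app (chart i)).hom.comp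
      ((Proj.awayToSection (grading N) (X i)).hom.comp (dehomogenize i)) from congr($this F)
  refine ringHom_ext (fun a ↦ ?_) fun j ↦ ?_
  · have hscalar := scalarMap_comp φ (ProjSpace.toSpec N) (chart i)
    rw [← h, scalarMap_comp_specMap, scalarMap_toSpec] at hscalar
    simpa [restrictToChart] using congr($hscalar a)
  · simp [restrictToChart, coordRatio, dehomogenize]

theorem evaluation_restrictToChart_map_eq_zero_iff
    (h : g ≫ Spec.map (CommRingCat.ofHom c) = φ ≫ ProjSpace.toSpec N) {i : Fin (N + 1)}
    {F : MvPolynomial (Fin (N + 1)) ℂ} {t : ℕ} (hF : F ∈ grading N t) {z : Z}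
    (hz : z ∈ φ ⁻¹ᵁ chart i) :
    Z.evaluation (φ ⁻¹ᵁ chart i) z hz (restrictToChart g φ i (map c F)) = 0 ↔
      F ∈ (φ z).asHomogeneousIdeal := by
  rw [restrictToChart_map h, dehomogenize_eq_mk i hF]
  refine (Eq.congr_left (Scheme.evaluation_naturality_apply φ z hz _).symm).trans ?_
  exact (map_eq_zero (φ.residueFieldMap z).hom).trans
    (evaluation_awayToSection_mk_eq_zero_iff (grading N) hz _)

end ProjSpace

section Forms

open MvPolynomial

/-- The form obtained from a form with coefficients in `R` by applying a ring homomorphism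
`R → S` to its coefficients. -/
def mapForm {σ R S : Type*} [CommSemiring R] [CommSemiring S] (f : R →+* S) {t : ℕ}
    (F : homogeneousSubmodule σ R t) : homogeneousSubmodule σ S t :=
  ⟨map f F, IsHomogeneous.map F.2 f⟩

theorem mapForm_surjective {σ R S : Type*} [CommSemiring R] [CommSemiring S] {f : R →+* S}
    (hf : Function.Surjective f) (t : ℕ) :
    Function.Surjective (mapForm f : homogeneousSubmodule σ R t → homogeneousSubmodule σ S t) := by
  intro F
  obtain ⟨G, hG⟩ := map_surjective f hf F.1
  refine ⟨⟨homogeneousComponent t G, homogeneousComponent_isHomogeneous t G⟩, ?_⟩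
  ext d
  rw [← homogeneousComponent_eq_self F.2, ← hG]
  simp only [mapForm, coeff_map, coeff_homogeneousComponent, apply_ite f, map_zero]

variable {K : Type} [Field K] {N : ℕ} {Z : Scheme.{0}} {g : Z ⟶ Spec (.of K)}
  {φ : Z ⟶ ProjSpace N} {c : ℂ →+* K}

theorem mapForm_mem_vanishingForms_iff [IsReduced Z]
    (h : g ≫ Spec.map (CommRingCat.ofHom c) = φ ≫ ProjSpace.toSpec N) {t : ℕ} (F : grading N t) :
    mapForm c F ∈ vanishingForms g φ t ↔ ∀ z : Z, F.1 ∈ (φ z).asHomogeneousIdeal := by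
  have hchart (i) : restrictToChart g φ i (map c F) = 0 ↔
      ∀ z : Z, z ∈ φ ⁻¹ᵁ chart i → F.1 ∈ (φ z).asHomogeneousIdeal := by
    rw [← basicOpen_eq_bot_iff, Scheme.basicOpen_eq_bot_iff_forall_evaluation_eq_zero,
      Subtype.forall]
    exact forall₂_congr fun z hz ↦ evaluation_restrictToChart_map_eq_zero_iff h F.2 hz
  refine (forall_congr' hchart).trans ⟨fun hF z ↦ ?_, fun hF i z _ ↦ hF z⟩
  obtain ⟨i, hi⟩ := exists_mem_chart (φ z)
  exact hF i z hi

/-- The value at a closed point `z` of the forms of degree `t`, computed in the chart `D₊(xᵢ)`: the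
residue of `F / xᵢ ^ t` at `z`, which lies in the base field `K` as `K` is algebraically closed. -/
def evalForm [IsAlgClosed K] (g : Z ⟶ Spec (.of K)) [LocallyOfFiniteType g] (φ : Z ⟶ ProjSpace N)
    (t : ℕ) {z : Z} (hz : IsClosed {z}) {i : Fin (N + 1)} (hi : z ∈ φ ⁻¹ᵁ chart i) :
    homogeneousSubmodule (Fin (N + 1)) K t →ₗ[K] K where
  toFun F := (residueFieldIsoBase g z hz).hom
    (Z.evaluation (φ ⁻¹ᵁ chart i) z hi (restrictToChart g φ i F))
  map_add' F G := by simp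
  map_smul' a F := by
    have hC : restrictToChart g φ i (C a) = scalarMap g _ a := eval₂Hom_C _ _ a
    simp only [Submodule.coe_smul, smul_eq_C_mul, map_mul, hC, RingHom.id_apply, smul_eq_mul]
    exact congrArg (· * _) (residueFieldIsoBase_hom_evaluation_scalarMap g _ hi hz a)

theorem evalForm_mapForm_eq_zero_iff [IsAlgClosed K] [LocallyOfFiniteType g]
    (h : g ≫ Spec.map (CommRingCat.ofHom c) = φ ≫ ProjSpace.toSpec N) {t : ℕ} (F : grading N t)
    {z : Z} (hz : IsClosed {z}) {i : Fin (N + 1)} (hi : z ∈ φ ⁻¹ᵁ chart i) :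
    evalForm g φ t hz hi (mapForm c F) = 0 ↔ F.1 ∈ (φ z).asHomogeneousIdeal :=
  (map_eq_zero_iff _ (ConcreteCategory.bijective_of_isIso (residueFieldIsoBase g z hz).hom).1).trans
    (evaluation_restrictToChart_map_eq_zero_iff h F.2 hi)

theorem vanishingForms_eq_iInf_ker_evalForm [IsAlgClosed K] [LocallyOfFiniteType g] [IsReduced Z]
    (h : g ≫ Spec.map (CommRingCat.ofHom c) = φ ≫ ProjSpace.toSpec N) (hc : Function.Surjective c)
    (hZ : ∀ z : Z, IsClosed {z}) {i : Z → Fin (N + 1)} (hi : ∀ z, z ∈ φ ⁻¹ᵁ chart (i z)) (t : ℕ) :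
    vanishingForms g φ t = ⨅ z, LinearMap.ker (evalForm g φ t (hZ z) (hi z)) := by
  ext F
  obtain ⟨G, rfl⟩ := mapForm_surjective hc t F
  simp only [mapForm_mem_vanishingForms_iff h, Submodule.mem_iInf, LinearMap.mem_ker,
    evalForm_mapForm_eq_zero_iff h]

end Forms

section HilbertFunction

variable {N : ℕ}

theorem eventually_exists_form_separating {ι : Type*} [Finite ι] {x : ι → ProjSpace N}
    (hx : Function.Injective x) (hcl : ∀ j, IsClosed {x j}) :
    ∀ᶠ t : ℕ in Filter.atTop, ∀ j, ∃ G : grading N t, G.1 ∉ (x j).asHomogeneousIdeal ∧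
      ∀ k ≠ j, G.1 ∈ (x k).asHomogeneousIdeal := by
  refine Filter.eventually_all.2 fun j ↦ ?_
  have hT : IsClosed (⋃ k ∈ ({j}ᶜ : Set ι), {x k}) :=
    (Set.toFinite _).isClosed_biUnion fun k _ ↦ hcl k
  have hj : x j ∉ ⋃ k ∈ ({j}ᶜ : Set ι), {x k} := fun h ↦ by
    obtain ⟨k, hk, hjk⟩ := Set.mem_iUnion₂.1 h
    exact hk (hx hjk).symm
  obtain ⟨d, G, hG, hGj, hGT⟩ := exists_homogeneous_notMem_of_notMem_isClosed (grading N) hT hj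
  obtain ⟨i, hi⟩ := exists_mem_chart (x j)
  filter_upwards [Filter.eventually_ge_atTop d] with t ht
  refine ⟨⟨MvPolynomial.X i ^ (t - d) * G, ?_⟩, fun hmem ↦ ?_, fun k hk ↦ ?_⟩
  · simpa [Nat.sub_add_cancel ht] using
      SetLike.mul_mem_graded (SetLike.pow_mem_graded (t - d) (X_mem_grading i)) hG
  · exact ((x j).isPrime.mem_or_mem hmem).elim (fun hX ↦ hi ((x j).isPrime.mem_of_pow_mem _ hX)) hGj
  · exact Ideal.mul_mem_left _ _ (hGT _ (Set.mem_biUnion hk rfl))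

variable {K : Type} [Field K] {Z : Scheme.{0}}

theorem eventually_hilbertFunction_eq_card [IsReduced Z] [Finite Z] {g : Z ⟶ Spec (.of K)}
    [LocallyOfFiniteType g] {φ : Z ⟶ ProjSpace N} [IsClosedImmersion φ] {c : ℂ →+* K}
    (h : g ≫ Spec.map (CommRingCat.ofHom c) = φ ≫ ProjSpace.toSpec N)
    (hc : Function.Surjective c) :
    ∀ᶠ t : ℕ in Filter.atTop, hilbertFunction g φ t = Nat.card Z := by
  have : IsAlgClosed K := .of_ringEquiv ℂ K (RingEquiv.ofBijective c ⟨c.injective, hc⟩)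
  have : JacobsonSpace Z := LocallyOfFiniteType.jacobsonSpace g
  have hφ := φ.isClosedEmbedding
  have hZ (z : Z) : IsClosed {z} := isClosed_singleton
  have hφZ (z : Z) : IsClosed {φ z} := by
    simpa only [Set.image_singleton] using hφ.isClosedMap _ (hZ z)
  have := Fintype.ofFinite Z
  choose i hi using fun z : Z ↦ exists_mem_chart (φ z)
  filter_upwards [eventually_exists_form_separating hφ.injective hφZ] with t ht
  choose G hGne hGzero using ht
  rw [hilbertFunction, vanishingForms_eq_iInf_ker_evalForm h hc hZ hi, Nat.card_eq_fintype_card]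
  exact finrank_quotient_iInf_ker_eq_card _ (fun z ↦ mapForm c (G z))
    (fun z ↦ (evalForm_mapForm_eq_zero_iff h _ _ _).not.2 (hGne z))
    fun z w hw ↦ (evalForm_mapForm_eq_zero_iff h _ _ _).2 (hGzero z w hw)

theorem hilbertFunction_pos [Nonempty Z] (g : Z ⟶ Spec (.of K)) (φ : Z ⟶ ProjSpace N) (t : ℕ) :
    0 < hilbertFunction g φ t := by
  have : Module.Finite K (MvPolynomial.homogeneousSubmodule (Fin (N + 1)) K t) :=
    Module.Finite.iff_fg.2 (MvPolynomial.homogeneousSubmodule_fg _ K t)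
  obtain ⟨z⟩ := ‹Nonempty Z›
  obtain ⟨i, hi⟩ := exists_mem_chart (φ z)
  have : Nonempty (φ ⁻¹ᵁ chart i) := ⟨⟨z, hi⟩⟩
  have hX : restrictToChart g φ i (MvPolynomial.X i ^ t) = 1 := by
    rw [map_pow, restrictToChart, MvPolynomial.eval₂Hom_X', coordRatio_self, map_one, one_pow]
  have hne : vanishingForms g φ t ≠ ⊤ := fun htop ↦
    have hmem : ⟨MvPolynomial.X i ^ t, MvPolynomial.isHomogeneous_X_pow i t⟩ ∈
      vanishingForms g φ t := htop ▸ Submodule.mem_top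
    one_ne_zero (hX.symm.trans (hmem i))
  have := Submodule.Quotient.nontrivial_iff.2 hne
  exact Module.finrank_pos

end HilbertFunction

section Scheme

universe u

variable {X : Scheme.{u}}

instance isReduced_subscheme_vanishingIdeal (A : TopologicalSpace.Closeds X) :
    IsReduced (Scheme.IdealSheafData.vanishingIdeal A).subscheme := by
  let I := Scheme.IdealSheafData.vanishingIdeal A
  let 𝒰 := I.subschemeCover.openCover
  have (i : X.affineOpens) : IsReduced (𝒰.X i) := by
    have h : (I.ideal i).IsRadical := PrimeSpectrum.isRadical_vanishingIdeal _
    have := (Ideal.isRadical_iff_quotient_reduced _).1 h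
    exact (affine_isReduced_iff (.of (Γ(X, i.1) ⧸ I.ideal i))).2 this
  exact @IsReduced.of_openCover _ 𝒰 this

theorem card_subscheme_vanishingIdeal (A : TopologicalSpace.Closeds X) :
    Nat.card (Scheme.IdealSheafData.vanishingIdeal A).subscheme = (A : Set X).ncard := by
  rw [← Scheme.IdealSheafData.coe_support_vanishingIdeal A,
    ← Scheme.IdealSheafData.range_subschemeι, ← Nat.card_coe_set_eq]
  exact (Nat.card_range_of_injective (Scheme.Hom.injective _)).symm

instance isIso_fromSpecResidueField [IsReduced X] [Subsingleton X] (x : X) :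
    IsIso (X.fromSpecResidueField x) := by
  have : IsClosedImmersion (X.fromSpecResidueField x) :=
    isClosed_singleton_iff_isClosedImmersion.1 (isClosed_discrete {x})
  have : Surjective (X.fromSpecResidueField x) :=
    ⟨fun y ↦ ⟨IsLocalRing.closedPoint _, Subsingleton.elim _ _⟩⟩
  exact isIso_of_isClosedImmersion_of_surjective _

instance isIso_fiberι [IsReduced X] [Subsingleton X] {Y : Scheme.{u}} (f : Y ⟶ X) (x : X) :
    IsIso (f.fiberι x) :=
  inferInstanceAs (IsIso (pullback.fst f (X.fromSpecResidueField x)))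

theorem infinite_closedPoints_of_topologicalKrullDim_pos {T : Type*} [TopologicalSpace T]
    [JacobsonSpace T] (h : 0 < topologicalKrullDim T) : (closedPoints T).Infinite := fun hfin ↦
  have := JacobsonSpace.discreteTopology hfin
  h.not_ge (topologicalKrullDim_zero_of_discreteTopology T)

end Scheme

namespace SmoothProjectiveCurve

variable (C : SmoothProjectiveCurve)

instance locallyOfFiniteType_str : LocallyOfFiniteType C.str := by
  have := C.smooth
  exact inferInstanceAs (LocallyOfFiniteType (C.ι ≫ ProjSpace.toSpec C.N))

section Family

variable {S : Scheme.{0}} {σ : S ⟶ Spec (.of ℂ)} (I : (C.prod σ).IdealSheafData)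

instance locallyOfFiniteType_familyMap : LocallyOfFiniteType (C.familyMap I) :=
  inferInstanceAs (LocallyOfFiniteType (I.subschemeι ≫ pullback.snd C.str σ))

instance locallyOfFiniteType_fibreStr (s : S) : LocallyOfFiniteType (C.fibreStr I s) :=
  inferInstanceAs (LocallyOfFiniteType (pullback.snd (C.familyMap I) (S.fromSpecResidueField s)))

theorem fibreStr_comp (s : S) : C.fibreStr I s ≫ S.fromSpecResidueField s ≫ σ =
    C.fibreToProjSpace I s ≫ ProjSpace.toSpec C.N := by
  have hprod : pullback.fst C.str σ ≫ C.ι ≫ ProjSpace.toSpec C.N = pullback.snd C.str σ ≫ σ :=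
    pullback.condition
  have hfiber := (C.familyMap I).fiber_fac s
  change (C.familyMap I).fiberToSpecResidueField s ≫ S.fromSpecResidueField s ≫ σ =
    ((C.familyMap I).fiberι s ≫ I.subschemeι ≫ pullback.fst C.str σ ≫ C.ι) ≫ ProjSpace.toSpec C.N
  rw [← reassoc_of% hfiber, familyMap]
  simp only [Category.assoc, hprod]

end Family

section Point

variable (I : (C.prod (𝟙 (Spec (.of ℂ)))).IdealSheafData)

instance isClosedImmersion_fibreToProjSpace (s : Spec (.of ℂ)) :
    IsClosedImmersion (C.fibreToProjSpace I s) :=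
  have := C.isClosedImmersion
  inferInstanceAs (IsClosedImmersion ((C.familyMap I).fiberι s ≫ I.subschemeι ≫
    pullback.fst C.str (𝟙 (Spec (.of ℂ))) ≫ C.ι))

theorem isHilbertFamily_of_isReduced_of_finite [IsReduced I.subscheme] [Finite I.subscheme]
    [Nonempty I.subscheme] : C.IsHilbertFamily I (constPoly (Nat.card I.subscheme)) := by
  let f (s) : C.fibre I s ⟶ I.subscheme := (C.familyMap I).fiberι s
  have hf (s) : IsIso (f s) := isIso_fiberι (C.familyMap I) s
  let e (s) : C.fibre I s ≃ I.subscheme := (f s).homeomorph.toEquiv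
  refine ⟨inferInstance, fun s ↦ (e s).nonempty, fun s ↦ ?_⟩
  have : IsReduced (C.fibre I s) := isReduced_of_isOpenImmersion (f s)
  have : Finite (C.fibre I s) := .of_equiv _ (e s).symm
  let c := Spec.preimage ((Spec (.of ℂ)).fromSpecResidueField s)
  have hc : Function.Bijective c.hom := by
    rw [← isIso_SpecMap_iff, Spec.map_preimage]
    infer_instance
  have hcompat : C.fibreStr I s ≫ Spec.map (CommRingCat.ofHom c.hom) =
      C.fibreToProjSpace I s ≫ ProjSpace.toSpec C.N := by
    rw [← fibreStr_comp, Category.comp_id]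
    exact congrArg _ (Spec.map_preimage _)
  filter_upwards [eventually_hilbertFunction_eq_card hcompat hc.2] with t ht
  rw [ht, Nat.card_congr (e s), constPoly, Polynomial.eval_C, Int.cast_natCast]

theorem infinite_closedPoints_prod : (closedPoints (C.prod (𝟙 (Spec (.of ℂ))))).Infinite := by
  have := LocallyOfFiniteType.jacobsonSpace (pullback.snd C.str (𝟙 (Spec (.of ℂ))))
  refine infinite_closedPoints_of_topologicalKrullDim_pos ?_
  rw [(pullback.fst C.str (𝟙 (Spec (.of ℂ)))).homeomorph.isHomeomorph.topologicalKrullDim_eq,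
    C.dim_eq_one]
  exact one_pos

theorem hilbNonempty_constPoly {n : ℕ} (hn : 0 < n) : C.HilbNonempty (constPoly n) := by
  obtain ⟨B, hB, rfl⟩ := C.infinite_closedPoints_prod.exists_subset_card_eq n
  have hBcl : IsClosed (B : Set (C.prod (𝟙 (Spec (.of ℂ))))) := by
    rw [← Set.biUnion_of_singleton (SetLike.coe B)]
    exact B.finite_toSet.isClosed_biUnion hB
  let I := Scheme.IdealSheafData.vanishingIdeal ⟨_, hBcl⟩
  have hcard : Nat.card I.subscheme = B.card :=
    (card_subscheme_vanishingIdeal _).trans (Set.ncard_coe_finset B)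
  obtain ⟨_, _⟩ := Nat.card_pos_iff.1 (hcard ▸ hn)
  exact ⟨Spec (.of ℂ), 𝟙 _, I, inferInstance, inferInstance,
    hcard ▸ C.isHilbertFamily_of_isReduced_of_finite I⟩

end Point

variable {C}

theorem HilbNonempty.eventually_eval_eq_natCast {P : Polynomial ℚ} (h : C.HilbNonempty P) :
    ∀ᶠ t : ℕ in Filter.atTop, ∃ m : ℕ, 0 < m ∧ P.eval (t : ℚ) = m := by
  obtain ⟨S, σ, I, -, ⟨s⟩, hI⟩ := h
  have := hI.nonempty_fibre s
  filter_upwards [hI.hasHilbertPolynomial s] with t ht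
  exact ⟨_, hilbertFunction_pos _ _ t, ht.symm⟩

variable (C) in
theorem hilbNonempty_constPoly_iff (k : ℤ) : C.HilbNonempty (constPoly k) ↔ 0 < k := by
  refine ⟨fun h ↦ ?_, fun hk ↦ ?_⟩
  · obtain ⟨t, m, hm, ht⟩ := h.eventually_eval_eq_natCast.exists
    have hkm : k = m := by exact_mod_cast Polynomial.eval_C.symm.trans ht
    exact hkm ▸ Int.natCast_pos.2 hm
  · lift k to ℕ using hk.le
    exact C.hilbNonempty_constPoly (Int.natCast_pos.1 hk)

theorem IsGoodPartition.eq_C {n s : ℕ} {Q : Fin s → Polynomial ℚ}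
    (h : C.IsGoodPartition (constPoly n) Q) (i : Fin s) : Q i = Polynomial.C ((Q i).coeff 0) := by
  refine eq_C_of_eventually_eval_natCast_mem_Icc (a := 0) (b := n) ?_
  filter_upwards [Filter.eventually_all.2 fun j ↦ (h.2 j).eventually_eval_eq_natCast] with t ht
  have hnonneg (j) : 0 ≤ (Q j).eval (t : ℚ) := by
    obtain ⟨m, -, hm⟩ := ht j
    exact hm ▸ m.cast_nonneg
  have hsum : ∑ j, (Q j).eval (t : ℚ) = n := by
    rw [← Polynomial.eval_finsetSum, h.1, constPoly, Polynomial.eval_C, Int.cast_natCast]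
  exact ⟨hnonneg i, hsum ▸ Finset.single_le_sum (f := fun j ↦ (Q j).eval (t : ℚ))
    (fun j _ ↦ hnonneg j) (Finset.mem_univ i)⟩

theorem IsGoodPartition.exists_isPartition {n s : ℕ} {Q : Fin s → Polynomial ℚ}
    (h : C.IsGoodPartition (constPoly n) Q) :
    ∃ m : Fin s → ℕ, IsPartition n m ∧ ∀ i, Q i = constPoly (m i) := by
  have hQ (i) : ∃ m : ℕ, 0 < m ∧ Q i = constPoly m := by
    obtain ⟨t, m, hm, ht⟩ := (h.2 i).eventually_eval_eq_natCast.exists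
    rw [h.eq_C i, Polynomial.eval_C] at ht
    exact ⟨m, hm, by rw [h.eq_C i, ht, constPoly, Int.cast_natCast]⟩
  choose m hm hQm using hQ
  refine ⟨m, ⟨?_, hm⟩, hQm⟩
  have hsum := h.1
  simp only [hQm, constPoly, ← map_sum, Polynomial.C_inj] at hsum
  exact_mod_cast hsum

end SmoothProjectiveCurve

theorem IsPartition.isGoodPartition (C : SmoothProjectiveCurve) {n s : ℕ} {m : Fin s → ℕ}
    (h : IsPartition n m) : C.IsGoodPartition (constPoly n) fun i ↦ constPoly (m i) :=
  ⟨by simp [constPoly, ← h.1], fun i ↦ C.hilbNonempty_constPoly (h.2 i)⟩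

end HilbertCurve

end

theorem lemma4p4 (C : HilbertCurve.SmoothProjectiveCurve) (n : ℕ) (hn : 0 < n) :
    -- every partition of `n` is a good partition of `n`
    (∀ (s : ℕ) (m : Fin s → ℕ), HilbertCurve.IsPartition n m →
      C.IsGoodPartition (HilbertCurve.constPoly n) fun i ↦ HilbertCurve.constPoly (m i)) ∧
    -- every good partition of `n` is a partition of `n`
    (∀ (s : ℕ) (Q : Fin s → Polynomial ℚ),
      C.IsGoodPartition (HilbertCurve.constPoly n) Q →
        ∃ m : Fin s → ℕ, HilbertCurve.IsPartition n m ∧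
          ∀ i, Q i = HilbertCurve.constPoly (m i)) ∧
    -- `Hilb_C^k` is nonempty precisely for positive `k`
    (∀ k : ℤ, C.HilbNonempty (HilbertCurve.constPoly k) ↔ 0 < k) :=
  ⟨fun _ _ h ↦ h.isGoodPartition C, fun _ _ h ↦ h.exists_isPartition, C.hilbNonempty_constPoly_iff⟩
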